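/- For positive integers $s_1,\dots,s_u$ put $$t^{\star}(s_1,\dots,s_u)=\sum_{k_1\ge\cdots\ge k_u\ge 0}\frac{1}{(2k_1+1)^{s_1}\cdots(2k_u+1)^{s_u}},\qquad t^{\star}(\emptyset)=1,$$ and for nonzero integers $s_1,\dots,s_u$ put $$t(s_1,\dots,s_u)=\lim_{n\to\infty}\ \sum_{n\ge k_1>\cdots>k_u\ge 1}\frac{\operatorname{sign}(s_1)^{k_1}\cdots\operatorname{sign}(s_u)^{k_u}}{(2k_1-1)^{|s_1|}\cdots(2k_u-1)^{|s_u|}}.$$ For a real number $r$ the interpolated alternating multiple $t$-value is $$t^{r}(s_1,\dots,s_u)=\sum_{\circ=\text{``}+\text{'' or ``},\text{''}} r^{\#\text{pluses}}\;t(s_1\circ s_2\circ\cdots\circ s_u),$$ the sum running over all $2^{u-1}$ choices, where the sum of two nonzero indices is understood as $s+l=|s|+|l|$ if $sl>0$ and $s+l=-(|s|+|l|)$ if $sl<0$. Write $\{s\}^m$ for $s$ repeated $m$ times (the empty string if $m\le 0$), and let $\delta(1)=1$ and $\delta(c)=0$ for $c\ge 3$. Let $d,b_0,b_1,\dots,b_d\ge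 0$ be integers and let $c_1,\dots,c_d$ be positive integers different from $2$, with $c_1\ge 3$ if $b_0=0$ and $d\ge 1$. Put $|\boldsymbol c|=c_1+\cdots+c_d$ and $\delta(\boldsymbol c)=\delta(c_1)+\cdots+\delta(c_d)$. Let $\boldsymbol\sigma$ be the following sequence of nonzero integers. If $d\ge1$, then $$\boldsymbol\sigma=\bigl(e_0,\{1\}^{c_1-3},e_1,\{1\}^{c_2-3},e_2,\dots,\{1\}^{c_{d-1}-3},e_{d-1},\{1\}^{c_d-3},e_d\bigr),$$ where $$e_0=(-1)^{\delta(c_1)-1}\bigl(2b_0+2-\delta(c_1)\bigr),$$ $$e_i=(-1)^{\delta(c_i)+\delta(c_{i+1})}\bigl(2b_i+3-\delta(c_i)-\delta(c_{i+1})\bigr)\quad(1\le i\le d-1),$$ $$e_d=(-1)^{\delta(c_d)}\bigl(2b_d+2-\delta(c_d)\bigr).$$ If $d=0$, then $\boldsymbol\sigma=(-(2b_0+1))$. Then the series defining $t^{\star}(\{2\}^{b_0},c_1,\{2\}^{b_1},\dots,c_d,\{2\}^{b_d})$ and all the limits entering $t^{1/2}(\boldsymbol\sigma)$ converge, and $$t^{\star}(\{2\}^{b_0},c_1,\{2\}^{b_1},\dots,c_d,\{2\}^{b_d})=-\frac{2^{|\boldsymbol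 c|+2-2d+2\delta(\boldsymbol c)}}{\pi}\;t^{1/2}(\boldsymbol\sigma).$$ -/

import Mathlib

open Filter Topology

noncomputable section

namespace MultipleT

/-- The truncated multiple `t`-star value: the nested sum, over
`n ≥ k₁ ≥ k₂ ≥ ⋯ ≥ k_u ≥ 0`, of `1 / ((2k₁+1)^{s₁} ⋯ (2k_u+1)^{s_u})`;
it is `1` for the empty index. -/
def tStarTrunc : ℕ → List ℕ → ℝ
  | _, [] => 1
  | n, s :: w => ∑ k ∈ Finset.range (n + 1), 1 / (2 * (k : ℝ) + 1) ^ s * tStarTrunc k w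

/-- The multiple `t`-star value `t⋆(s₁, …, s_u)`, a series over
`k₁ ≥ ⋯ ≥ k_u ≥ 0` with odd denominators `2kᵢ + 1`. -/
def tStar (s : List ℕ) : ℝ := limUnder atTop fun n => tStarTrunc n s

/-- The truncated alternating multiple `t`-value: the nested sum, over
`n ≥ k₁ > k₂ > ⋯ > k_u ≥ 1`, of
`sign(s₁)^{k₁} ⋯ sign(s_u)^{k_u} / ((2k₁-1)^{|s₁|} ⋯ (2k_u-1)^{|s_u|})`. -/
def altTTrunc : ℕ → List ℤ → ℝ
  | _, [] => 1
  | n, s :: w => ∑ k ∈ Finset.Icc 1 n,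
      (s.sign : ℝ) ^ k / (2 * (k : ℝ) - 1) ^ s.natAbs * altTTrunc (k - 1) w

/-- The alternating multiple `t`-value `t(s₁, …, s_u)`, summed in the order of the outermost
variable `k₁` (for `s₁ = -1` the series converges only conditionally). -/
def altT (s : List ℤ) : ℝ := limUnder atTop fun n => altTTrunc n s

/-- The signed addition of nonzero integers: absolute values are added and signs multiplied. -/
def signedAdd (s l : ℤ) : ℤ := if 0 < s * l then |s| + |l| else -(|s| + |l|)

/-- All `s₁ ∘ s₂ ∘ ⋯ ∘ s_u`, where each `∘` is a comma or a (signed) plus; every one of the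
`2^{u-1}` choices is listed, together with its number of pluses. The first argument is `s₁`,
the second is `(s₂, …, s_u)`. -/
def contractionsFrom : ℤ → List ℤ → List (ℕ × List ℤ)
  | s, [] => [(0, [s])]
  | s, l :: w =>
      (contractionsFrom l w).map (fun p => (p.1, s :: p.2)) ++
        (contractionsFrom (signedAdd s l) w).map (fun p => (p.1 + 1, p.2))

/-- As `contractionsFrom`, for an index given as one list. -/
def contractions : List ℤ → List (ℕ × List ℤ)
  | [] => [(0, [])]
  | s :: w => contractionsFrom s w

/-- The interpolated alternating multiple `t`-value `t^r(s)`: the sum of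
`r^{number of pluses} * t(s₁ ∘ ⋯ ∘ s_u)` over all choices of the symbols `∘`. -/
def interpT (r : ℝ) (s : List ℤ) : ℝ :=
  ((contractions s).map fun p => r ^ p.1 * altT p.2).sum

/-- `δ(1) = 1` and `δ(c) = 0` for `c ≥ 3`. -/
def delta (c : ℕ) : ℕ := if c = 1 then 1 else 0

/-- The index `({2}^{b₀}, c₁, {2}^{b₁}, …, c_d, {2}^{b_d})`, with the pairs `(cᵢ, bᵢ)` in a list. -/
def starIndex : ℕ → List (ℕ × ℕ) → List ℕ
  | b₀, [] => List.replicate b₀ 2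
  | b₀, (c, b) :: l => List.replicate b₀ 2 ++ c :: starIndex b l

/-- The part of the signed index which begins with the entry of the block `{2}^b` that comes
after `c`: an entry between `c` and `c'` is
`(-1)^{δ(c)+δ(c')} (2b+3-δ(c)-δ(c'))` and is followed by `{1}^{c'-3}` (empty if `c' = 1`);
the last entry is `(-1)^{δ(c)} (2b+2-δ(c))`. -/
def signedTail : ℕ → ℕ → List (ℕ × ℕ) → List ℤ
  | c, b, [] => [(-1) ^ delta c * (2 * (b : ℤ) + 2 - delta c)]
  | c, b, (c', b') :: l =>
      ((-1) ^ (delta c + delta c') * (2 * (b : ℤ) + 3 - delta c - delta c')) ::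
        (List.replicate (c' - 3) 1 ++ signedTail c' b' l)

/-- The signed index. For `d ≥ 1` its first entry is `(-1)^{δ(c₁)-1} (2b₀+2-δ(c₁))`, followed by
`{1}^{c₁-3}`; for `d = 0` it is the single entry `-(2b₀+1)`.
(The exponent `δ(c₁)+1` has the parity of `δ(c₁)-1`.) -/
def signedIndex : ℕ → List (ℕ × ℕ) → List ℤ
  | b₀, [] => [-(2 * (b₀ : ℤ) + 1)]
  | b₀, (c, b) :: l =>
      ((-1) ^ (delta c + 1) * (2 * (b₀ : ℤ) + 2 - delta c)) ::
        (List.replicate (c - 3) 1 ++ signedTail c b l)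

/-- The list `[(c₁, b₁), …, (c_d, b_d)]`. -/
def pairs {d : ℕ} (b : Fin (d + 1) → ℕ) (c : Fin d → ℕ) : List (ℕ × ℕ) :=
  List.ofFn fun i : Fin d => (c i, b i.succ)

end MultipleT

end

/-!
For each row `n` there are positive weights `weight n k`, `k ≤ n`, essentially binomial coefficients
of row `2n+1`, coming from the partial fractions of `∏_{j ≤ n} (1 - x² / (2j+1)²)⁻¹`. Every truncated
`t`-star sum of length `n` is a weighted sum `∑ weight n k * f k` with a sequence `f` that does not
depend on `n` (`tStarTrunc_eq_weightedSum`). The empty index has `f k = (-1)^k / (2k+1)`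
(`weightedSum_leibniz`), and prepending an entry `c`, that is, multiplying by `(2n+1)^{-c}` and
summing over `n`, acts on `f` through two rules:

* multiplying `f` by `(2k+1)^{-2}` corresponds to multiplying by `(2n+1)^{-2}` and summing over
  `n` (`weightedSum_div_sq`);
* applying `(2k+1) J`, where `J f k = f k + 2 ∑_{l<k} f l`, corresponds to multiplying by `2n+1`
  (`weightedSum_mul_midSum`); the inverse of this operator is `ε J ε (2k+1)⁻¹` with `ε = (-1)^k`
  (`weightedSum_divRow`).

Hence `2` multiplies `f` by `(2k+1)⁻²`, `1` contributes `(2k+1)⁻¹ J`, and `c ≥ 3` contributes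
`ε (2k+1)⁻² J ((2k+1)⁻¹ J)^{c-3} (2k+1)⁻¹ ε`. Since `J` is twice the summation operator with weight
`1/2` on the diagonal, and adding indices with their signs multiplies their summation factors, the
product of these operators is the iterated sum of an interpolated value with `r = 1/2`: the
powers of `(2k+1)⁻¹` and `ε` between two factors `J` combine to one entry of the signed
index, and the runs of `1` come from the `c - 3` inner factors (`starTerm_starIndex`). The factors
`2` and the product of the signs, which is `-1`, make up the constant.

Finally `weight n k` tends to `4 / π` by the Wallis product and is bounded by `4 / π`, so that
dominated convergence gives the limit (`tendsto_weightedSum`), the first entry of the signed index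
having absolute value at least `2`. The only exception is the signed index `(-1)`, which is the
Leibniz series.
-/

namespace MultipleT

/-! ### Binomial weights -/

/-- The weight of `k` in the expansion of a truncated `t`-star sum of length `n`: times
`(-1)^k / (2k+1)` it is the coefficient of `(1 - x² / (2k+1)²)⁻¹` in the partial fraction expansion
of `∏_{j ≤ n} (1 - x² / (2j+1)²)⁻¹`. It vanishes for `k > n`. -/
noncomputable def weight (n k : ℕ) : ℝ :=
  (2 * n + 1) * n.centralBinom * (2 * n + 1).choose (n + k + 1) / 16 ^ n

/-- The companion of `weight` built on row `2n` of Pascal's triangle: sums and differences of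
its consecutive values are multiples of `weight`. -/
noncomputable def halfWeight (n k : ℕ) : ℝ :=
  (2 * n + 1) ^ 2 * n.centralBinom * (2 * n).choose (n + k) / 16 ^ n

theorem weight_eq_zero {n k : ℕ} (h : n < k) : weight n k = 0 := by
  simp [weight, Nat.choose_eq_zero_of_lt (show 2 * n + 1 < n + k + 1 by omega)]

theorem halfWeight_eq_zero {n k : ℕ} (h : n < k) : halfWeight n k = 0 := by
  simp [halfWeight, Nat.choose_eq_zero_of_lt (show 2 * n < n + k by omega)]

theorem weight_nonneg (n k : ℕ) : 0 ≤ weight n k := by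
  unfold weight; positivity

theorem row_mul_weight (n k : ℕ) :
    (2 * n + 1) * weight n k = halfWeight n k + halfWeight n (k + 1) := by
  have h : ((2 * n + 1).choose (n + k + 1) : ℝ)
      = (2 * n).choose (n + k) + (2 * n).choose (n + (k + 1)) := by
    exact_mod_cast Nat.choose_succ_succ (2 * n) (n + k)
  rw [weight, halfWeight, halfWeight, h]; ring

theorem col_mul_weight (n k : ℕ) :
    (2 * k + 1) * weight n k = halfWeight n k - halfWeight n (k + 1) := by
  have h : ((2 * n + 1).choose (n + k + 1) : ℝ)
      = (2 * n).choose (n + k) + (2 * n).choose (n + (k + 1)) := by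
    exact_mod_cast Nat.choose_succ_succ (2 * n) (n + k)
  have h2 : ((2 * n + 1 : ℝ)) * (2 * n).choose (n + k)
      = (2 * n + 1).choose (n + k + 1) * (n + k + 1) := by
    exact_mod_cast Nat.add_one_mul_choose_eq (2 * n) (n + k)
  have h3 : (2 * k + 1 : ℝ) * (2 * n + 1).choose (n + k + 1)
      = (2 * n + 1) * ((2 * n).choose (n + k) - (2 * n).choose (n + (k + 1))) := by
    linear_combination (-2) * h2 + (-(2 * n + 1) : ℝ) * h
  rw [weight, halfWeight, halfWeight]
  linear_combination ((2 * n + 1) * n.centralBinom / 16 ^ n : ℝ) * h3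

/-- The rows satisfy `((2n+3)² - (2k+1)²) weight (n+1) k = (2n+3)² weight n k`; in this form the
recursion turns division of a sequence by `(2k+1)²` into a sum over rows. -/
theorem weight_succ_sub (n k : ℕ) :
    weight (n + 1) k - weight n k = (2 * k + 1) ^ 2 * weight (n + 1) k / (2 * n + 3) ^ 2 := by
  rcases le_or_gt k (n + 1) with hk | hk
  · have h1 : ((2 * n + 3 : ℝ)) * (2 * n + 2).choose (n + k + 1)
        = (2 * n + 3).choose (n + k + 2) * (n + k + 2) := by
      exact_mod_cast Nat.add_one_mul_choose_eq (2 * n + 2) (n + k + 1)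
    have h2 : ((2 * n + 1).choose (n + k + 1) : ℝ) * (2 * n + 2)
        = (2 * n + 2).choose (n + k + 1) * (n + 1 - k) := by
      have h := Nat.choose_mul_succ_eq (2 * n + 1) (n + k + 1)
      rw [show 2 * n + 1 + 1 - (n + k + 1) = n + 1 - k by omega] at h
      have h' : ((n + 1 - k : ℕ) : ℝ) = n + 1 - k := by rw [Nat.cast_sub hk]; push_cast; ring
      rw [← h']
      exact_mod_cast h
    have h3 : (n + 1 : ℝ) * (n + 1).centralBinom = 2 * (2 * n + 1) * n.centralBinom := by
      exact_mod_cast Nat.succ_mul_centralBinom_succ n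
    rw [eq_div_iff (by positivity), weight, weight]
    rw [show 2 * (n + 1) + 1 = 2 * n + 3 by ring, show n + 1 + k + 1 = n + k + 2 by ring, pow_succ]
    push_cast
    field_simp
    linear_combination
      (-4 * (2 * (n : ℝ) + 3) * (n + 1).centralBinom * (n + 1 - k)) * h1
      - (4 * (2 * (n : ℝ) + 3) ^ 2 * (n + 1).centralBinom) * h2
      + (8 * (2 * (n : ℝ) + 3) ^ 2 * (2 * n + 1).choose (n + k + 1)) * h3
  · rw [weight_eq_zero hk, weight_eq_zero (by omega)]; simp

/-- The linear functional on sequences given by the weights of row `n`. -/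
noncomputable def weightedSum (n : ℕ) (f : ℕ → ℝ) : ℝ :=
  ∑ k ∈ Finset.range (n + 1), weight n k * f k

theorem weightedSum_succ_sub (n : ℕ) (f : ℕ → ℝ) :
    weightedSum (n + 1) f - weightedSum n f
      = weightedSum (n + 1) (fun k => (2 * k + 1) ^ 2 * f k) / (2 * n + 3) ^ 2 := by
  have h : weightedSum n f = ∑ k ∈ Finset.range (n + 1 + 1), weight n k * f k := by
    rw [Finset.sum_range_succ _ (n + 1), weight_eq_zero (Nat.lt_succ_self n), zero_mul, add_zero]
    rfl
  rw [h, weightedSum, weightedSum, ← Finset.sum_sub_distrib, Finset.sum_div]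
  refine Finset.sum_congr rfl fun k _ => ?_
  rw [← sub_mul, weight_succ_sub]; ring

theorem weightedSum_zero (f : ℕ → ℝ) : weightedSum 0 f = f 0 := by
  simp [weightedSum, weight]

/-- The sequence of the empty index: its weighted sums are all `1`. -/
theorem weightedSum_leibniz (n : ℕ) :
    weightedSum n (fun k => (-1) ^ k / (2 * k + 1)) = 1 := by
  induction n with
  | zero => simp [weightedSum_zero]
  | succ n ih =>
    -- the alternating sum that measures the change from row `n` to row `n + 1` telescopes
    have key : ∀ M : ℕ, ∑ k ∈ Finset.range M, (-1 : ℝ) ^ k * ((2 * k + 1) * weight (n + 1) k)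
        = (2 * (n + 1) + 1) ^ 2 * (n + 1).centralBinom / 16 ^ (n + 1)
          * (-((-1) ^ M * ((2 * n + 1).choose (n + M) - (2 * n + 1).choose (n + M + 1)))) := by
      intro M
      induction M with
      | zero => simp [Nat.choose_symm_half]
      | succ M ih =>
        have e1 : ((2 * (n + 1)).choose (n + 1 + M) : ℝ)
            = (2 * n + 1).choose (n + M) + (2 * n + 1).choose (n + M + 1) := by
          rw [show n + 1 + M = n + M + 1 by ring]
          exact_mod_cast Nat.choose_succ_succ (2 * n + 1) (n + M)
        have e2 : ((2 * (n + 1)).choose (n + 1 + (M + 1)) : ℝ)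
            = (2 * n + 1).choose (n + M + 1) + (2 * n + 1).choose (n + M + 2) := by
          rw [show n + 1 + (M + 1) = n + M + 1 + 1 by ring]
          exact_mod_cast Nat.choose_succ_succ (2 * n + 1) (n + M + 1)
        rw [Finset.sum_range_succ, ih, col_mul_weight, halfWeight, halfWeight, e1, e2, pow_succ,
          show n + (M + 1) = n + M + 1 by ring, show n + M + 1 + 1 = n + M + 2 by ring]
        push_cast
        ring
    have hz : weightedSum (n + 1) (fun k => (2 * k + 1) ^ 2 * ((-1) ^ k / (2 * k + 1))) = 0 := by
      have h := key (n + 1 + 1)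
      rw [Nat.choose_eq_zero_of_lt (show 2 * n + 1 < n + (n + 1 + 1) by omega),
        Nat.choose_eq_zero_of_lt (show 2 * n + 1 < n + (n + 1 + 1) + 1 by omega)] at h
      simp only [Nat.cast_zero, sub_zero, mul_zero, neg_zero] at h
      rw [← h, weightedSum]
      refine Finset.sum_congr rfl fun k _ => ?_
      field_simp
    have := weightedSum_succ_sub n (fun k => (-1) ^ k / (2 * k + 1))
    rw [hz, ih, zero_div] at this
    linarith

theorem weightedSum_div_sq (n : ℕ) (f : ℕ → ℝ) :
    weightedSum n (fun k => f k / (2 * k + 1) ^ 2)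
      = ∑ m ∈ Finset.range (n + 1), weightedSum m f / (2 * m + 1) ^ 2 := by
  induction n with
  | zero => simp [weightedSum_zero]
  | succ n ih =>
    rw [Finset.sum_range_succ, ← ih, ← sub_eq_iff_eq_add', weightedSum_succ_sub]
    congr 1
    · congr 1
      ext k
      field_simp
    · push_cast; ring

/-! ### Multiplication and division by the truncation parameter -/

/-- Twice the summation operator in which the top term has weight one half. -/
noncomputable def midSum (f : ℕ → ℝ) (k : ℕ) : ℝ := f k + 2 * ∑ l ∈ Finset.range k, f l

/-- The operator on sequences that divides the weighted sum of row `n` by `2n+1`. -/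
noncomputable def divRow (f : ℕ → ℝ) (k : ℕ) : ℝ :=
  (-1) ^ k * midSum (fun l => (-1) ^ l * (f l / (2 * l + 1))) k

theorem weightedSum_mul_midSum (n : ℕ) (f : ℕ → ℝ) :
    weightedSum n (fun k => (2 * k + 1) * midSum f k) = (2 * n + 1) * weightedSum n f := by
  -- summation by parts, with the boundary term kept
  have key : ∀ N : ℕ, ∑ k ∈ Finset.range N, weight n k * ((2 * k + 1) * midSum f k)
      = ∑ k ∈ Finset.range N, (2 * n + 1) * (weight n k * f k)
        - 2 * halfWeight n N * ∑ l ∈ Finset.range N, f l := by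
    intro N
    induction N with
    | zero => simp
    | succ N ih =>
      rw [Finset.sum_range_succ, ih, Finset.sum_range_succ _ N, Finset.sum_range_succ f N, midSum]
      linear_combination (f N + 2 * ∑ l ∈ Finset.range N, f l) * col_mul_weight n N
        - f N * row_mul_weight n N
  rw [weightedSum, key, halfWeight_eq_zero (Nat.lt_succ_self n), weightedSum,
    ← Finset.mul_sum]
  simp

/-- The operator `J = midSum` is inverted by conjugation with the sequence of signs `(-1)^k`. -/
theorem midSum_alternating_midSum (g : ℕ → ℝ) (k : ℕ) :
    midSum (fun l => (-1) ^ l * midSum g l) k = (-1) ^ k * g k := by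
  have key : ∀ k : ℕ, ∑ l ∈ Finset.range k, (-1) ^ l * midSum g l
      = -((-1) ^ k * ∑ l ∈ Finset.range k, g l) := by
    intro k
    induction k with
    | zero => simp
    | succ k ih => rw [Finset.sum_range_succ, ih, Finset.sum_range_succ, midSum, pow_succ]; ring
  rw [midSum, key, midSum]; ring

theorem neg_one_pow_mul_self_mul (k : ℕ) (x : ℝ) : (-1) ^ k * ((-1) ^ k * x) = x := by
  rw [← mul_assoc, ← mul_pow]; simp

theorem weightedSum_divRow (n : ℕ) (f : ℕ → ℝ) :
    weightedSum n (divRow f) = weightedSum n f / (2 * n + 1) := by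
  rw [eq_div_iff (by positivity), mul_comm, ← weightedSum_mul_midSum]
  congr 1
  ext k
  have h : midSum (divRow f) k = f k / (2 * k + 1) := by
    unfold divRow
    rw [midSum_alternating_midSum, neg_one_pow_mul_self_mul]
  rw [h]; field_simp

theorem weightedSum_divRow_iterate (n j : ℕ) (f : ℕ → ℝ) :
    weightedSum n (divRow^[j] f) = weightedSum n f / (2 * n + 1) ^ j := by
  induction j with
  | zero => simp
  | succ j ih => rw [Function.iterate_succ_apply', weightedSum_divRow, ih, pow_succ, div_div]

/-! ### Truncated star sums as weighted sums -/

/-- The sequence whose weighted sum of row `n` is the truncated `t`-star sum of the index. -/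
noncomputable def starTerm : List ℕ → ℕ → ℝ
  | [] => fun k => (-1) ^ k / (2 * k + 1)
  | c :: w => fun k =>
      (if c = 1 then (2 * k + 1) * midSum (starTerm w) k else divRow^[c - 2] (starTerm w) k)
        / (2 * k + 1) ^ 2

theorem tStarTrunc_eq_weightedSum (w : List ℕ) (hw : ∀ c ∈ w, 1 ≤ c) (n : ℕ) :
    tStarTrunc n w = weightedSum n (starTerm w) := by
  induction w generalizing n with
  | nil => exact (weightedSum_leibniz n).symm
  | cons c w ih =>
    have hc : 1 ≤ c := hw c (by simp)
    have ih' := ih fun x hx => hw x (by simp [hx])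
    rw [tStarTrunc]
    unfold starTerm
    rw [weightedSum_div_sq]
    refine Finset.sum_congr rfl fun m _ => ?_
    rw [ih' m]
    have hm : (2 * m + 1 : ℝ) ≠ 0 := by positivity
    by_cases h1 : c = 1
    · simp only [h1, if_true]
      rw [weightedSum_mul_midSum]
      field_simp
    · simp only [h1, if_false]
      obtain ⟨j, rfl⟩ : ∃ j, c = j + 2 := ⟨c - 2, by omega⟩
      have e : weightedSum m (fun k => divRow^[j + 2 - 2] (starTerm w) k)
          = weightedSum m (starTerm w) / (2 * m + 1) ^ j := by
        simpa using weightedSum_divRow_iterate m j (starTerm w)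
      rw [e, pow_add]
      field_simp

/-! ### Limit of the weights -/

theorem weight_zero_eq (n : ℕ) :
    weight n 0 = (2 * n + 1) / (n + 1) * (Real.Wallis.W n)⁻¹ := by
  have h1 : ((2 * n + 1 : ℝ)) * n.centralBinom = (2 * n + 1).choose (n + 1) * (n + 1) := by
    have := Nat.add_one_mul_choose_eq (2 * n) n
    rw [Nat.centralBinom_eq_two_mul_choose]
    exact_mod_cast this
  have h2 : (n.centralBinom : ℝ) * (n.factorial * n.factorial) = (2 * n).factorial := by
    have := Nat.choose_mul_factorial_mul_factorial (show n ≤ 2 * n by omega)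
    rw [show 2 * n - n = n by omega, ← Nat.centralBinom_eq_two_mul_choose, mul_assoc] at this
    exact_mod_cast this
  rw [Real.Wallis.W_eq_factorial_ratio, weight, ← h2, add_zero, pow_mul]
  have : (n.factorial : ℝ) ≠ 0 := by positivity
  have : (n.centralBinom : ℝ) ≠ 0 := by exact_mod_cast n.centralBinom_ne_zero
  norm_num
  field_simp
  linear_combination -h1

theorem weight_succ_le (n k : ℕ) : weight n (k + 1) ≤ weight n k := by
  unfold weight
  have : (2 * n + 1).choose (n + (k + 1) + 1) ≤ (2 * n + 1).choose (n + k + 1) := by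
    have h := Nat.choose_succ_right_eq (2 * n + 1) (n + k + 1)
    have h' : (2 * n + 1).choose (n + k + 2) * (n + k + 2)
        ≤ (2 * n + 1).choose (n + k + 1) * (n + k + 2) := by
      rw [show n + k + 2 = n + k + 1 + 1 by ring, h]
      gcongr; omega
    exact Nat.le_of_mul_le_mul_right h' (by omega)
  gcongr

theorem weight_le (n k : ℕ) : weight n k ≤ 4 / Real.pi := by
  have h0 : weight n k ≤ weight n 0 := by
    induction k with
    | zero => rfl
    | succ k ih => exact (weight_succ_le n k).trans ih
  refine h0.trans ?_
  rw [weight_zero_eq]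
  have hW := Real.Wallis.le_W n
  have hWpos := Real.Wallis.W_pos n
  have hpi := Real.pi_pos
  rw [← div_eq_mul_inv, div_div, div_le_div_iff₀ (by positivity) hpi]
  rw [div_mul_eq_mul_div, div_le_iff₀ (by positivity)] at hW
  nlinarith

theorem tendsto_weight (k : ℕ) :
    Tendsto (fun n => weight n k) atTop (𝓝 (4 / Real.pi)) := by
  have hlin : ∀ a b : ℝ, Tendsto (fun n : ℕ => ((n : ℝ) + a) / (n + b)) atTop (𝓝 1) := by
    intro a b
    have := tendsto_add_mul_div_add_mul_atTop_nhds (𝕜 := ℝ) a b 1 one_ne_zero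
    simpa [add_comm] using this
  induction k with
  | zero =>
    have h1 : Tendsto (fun n : ℕ => (2 * ((n : ℝ) + 1 / 2) / (n + 1))) atTop (𝓝 (2 * 1)) := by
      simpa [mul_div_assoc] using (hlin (1 / 2) 1).const_mul 2
    have h2 := h1.mul (Real.Wallis.tendsto_W_nhds_pi_div_two.inv₀ (by positivity))
    rw [show 2 * 1 * (Real.pi / 2)⁻¹ = 4 / Real.pi by field_simp; norm_num] at h2
    refine h2.congr fun n => ?_
    rw [weight_zero_eq]; congr 2; ring
  | succ k ih =>
    have h := ih.mul (hlin (-k) (k + 2))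
    rw [mul_one] at h
    refine h.congr' ?_
    filter_upwards [eventually_ge_atTop k] with n hn
    have h := Nat.choose_succ_right_eq (2 * n + 1) (n + k + 1)
    rw [show 2 * n + 1 - (n + k + 1) = n - k by omega] at h
    have h' : ((2 * n + 1).choose (n + (k + 1) + 1) : ℝ) * (n + k + 2)
        = (2 * n + 1).choose (n + k + 1) * (n - k) := by
      rw [← Nat.cast_sub hn]
      exact_mod_cast h
    have hpos : (0 : ℝ) < n + (k + 2) := by positivity
    rw [mul_div_assoc', div_eq_iff hpos.ne', weight, weight]
    linear_combination (-(2 * n + 1) * n.centralBinom / 16 ^ n : ℝ) * h'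

theorem tendsto_weightedSum {f : ℕ → ℝ} (hf : Summable f) :
    Tendsto (fun n => weightedSum n f) atTop (𝓝 (4 / Real.pi * ∑' k, f k)) := by
  have h : ∀ n, weightedSum n f = ∑' k, weight n k * f k := by
    intro n
    rw [tsum_eq_sum (s := Finset.range (n + 1))]
    · rfl
    · intro k hk
      rw [weight_eq_zero (by simpa using hk), zero_mul]
  simp_rw [h]
  rw [← tsum_mul_left]
  refine tendsto_tsum_of_dominated_convergence (bound := fun k => 4 / Real.pi * |f k|)
    (hf.abs.mul_left _) (fun k => (tendsto_weight k).mul_const _) (Eventually.of_forall fun n k => ?_)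
  rw [Real.norm_eq_abs, abs_mul, abs_of_nonneg (weight_nonneg n k)]
  exact mul_le_mul_of_nonneg_right (weight_le n k) (abs_nonneg _)

/-! ### Interpolated sums as iterated sums -/

/-- The factor `sign(s)^k / (2k-1)^{|s|}` of an alternating `t`-sum, with `k` shifted to start
at `0`. -/
noncomputable def indexFactor (s : ℤ) (k : ℕ) : ℝ := (s.sign : ℝ) ^ (k + 1) / (2 * k + 1) ^ s.natAbs

theorem indexFactor_natCast {m : ℕ} (hm : 0 < m) (k : ℕ) :
    indexFactor m k = 1 / (2 * k + 1) ^ m := by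
  simp [indexFactor, Int.sign_eq_one_of_pos (Int.natCast_pos.2 hm)]

theorem indexFactor_neg_natCast {m : ℕ} (hm : 0 < m) (k : ℕ) :
    indexFactor (-m) k = (-1) ^ (k + 1) / (2 * k + 1) ^ m := by
  simp [indexFactor, Int.sign_eq_one_of_pos (Int.natCast_pos.2 hm)]

theorem altTTrunc_cons (n : ℕ) (s : ℤ) (w : List ℤ) :
    altTTrunc n (s :: w) = ∑ k ∈ Finset.range n, indexFactor s k * altTTrunc k w := by
  rw [altTTrunc]
  induction n with
  | zero => simp
  | succ n ih =>
    rw [Finset.sum_Icc_succ_top (by omega), ih, Finset.sum_range_succ, indexFactor]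
    congr 3
    push_cast; ring

theorem natAbs_signedAdd (s l : ℤ) : (signedAdd s l).natAbs = s.natAbs + l.natAbs := by
  unfold signedAdd; split <;> simp only [Int.abs_eq_natAbs] <;> omega

theorem sign_signedAdd {s l : ℤ} (hs : s ≠ 0) (hl : l ≠ 0) :
    (signedAdd s l).sign = s.sign * l.sign := by
  have h : 0 < |s| + |l| := by positivity
  rw [← Int.sign_mul]
  unfold signedAdd
  split_ifs with h'
  · rw [Int.sign_eq_one_of_pos h, Int.sign_eq_one_of_pos h']
  · rw [Int.sign_neg, Int.sign_eq_one_of_pos h, Int.sign_eq_neg_one_of_neg]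
    exact lt_of_le_of_ne (not_lt.1 h') (mul_ne_zero hs hl)

theorem indexFactor_signedAdd {s l : ℤ} (hs : s ≠ 0) (hl : l ≠ 0) (k : ℕ) :
    indexFactor (signedAdd s l) k = indexFactor s k * indexFactor l k := by
  rw [indexFactor, natAbs_signedAdd, sign_signedAdd hs hl, indexFactor, indexFactor,
    Int.cast_mul, mul_pow, pow_add _ s.natAbs, mul_div_mul_comm]

/-- The contribution of the outermost variable `k` to the interpolated sum: a plus puts the weight
`r` on the diagonal term of the next summation. The value at the empty index is never used. -/
noncomputable def interpTerm (r : ℝ) : List ℤ → ℕ → ℝ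
  | [] => fun _ => 0
  | [s] => indexFactor s
  | s :: l :: w => fun k => indexFactor s k *
      (r * interpTerm r (l :: w) k + ∑ j ∈ Finset.range k, interpTerm r (l :: w) j)

theorem interpTerm_signedAdd (r : ℝ) {s l : ℤ} (hs : s ≠ 0) (hl : l ≠ 0) (w : List ℤ) (k : ℕ) :
    interpTerm r (signedAdd s l :: w) k = indexFactor s k * interpTerm r (l :: w) k := by
  cases w with
  | nil => simp only [interpTerm]; exact indexFactor_signedAdd hs hl k
  | cons t w => simp only [interpTerm]; rw [indexFactor_signedAdd hs hl, mul_assoc]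

theorem signedAdd_ne_zero {s : ℤ} (l : ℤ) (hs : s ≠ 0) : signedAdd s l ≠ 0 := by
  have := natAbs_signedAdd s l
  omega

theorem list_sum_map_finset_sum {α : Type*} (L : List α) (S : Finset ℕ) (F : α → ℕ → ℝ) :
    (L.map fun p => ∑ k ∈ S, F p k).sum = ∑ k ∈ S, (L.map fun p => F p k).sum := by
  induction L with
  | nil => simp
  | cons a L ih => simp [ih, Finset.sum_add_distrib]

theorem sum_contractionsFrom (r : ℝ) (w : List ℤ) (hw : ∀ x ∈ w, x ≠ 0) (s : ℤ) (hs : s ≠ 0)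
    (n : ℕ) :
    ((contractionsFrom s w).map fun p => r ^ p.1 * altTTrunc n p.2).sum
      = ∑ k ∈ Finset.range n, interpTerm r (s :: w) k := by
  induction w generalizing s n with
  | nil =>
    have h : altTTrunc n [s] = ∑ k ∈ Finset.range n, indexFactor s k := by
      rw [altTTrunc_cons]; simp [altTTrunc]
    simpa [contractionsFrom, interpTerm] using h
  | cons l w ih =>
    have hl : l ≠ 0 := hw l (by simp)
    have ih' := ih fun x hx => hw x (by simp [hx])
    have h1 : ((contractionsFrom l w).map fun p => r ^ p.1 * altTTrunc n (s :: p.2)).sum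
        = ∑ k ∈ Finset.range n, indexFactor s k *
            ∑ j ∈ Finset.range k, interpTerm r (l :: w) j := by
      simp_rw [altTTrunc_cons, Finset.mul_sum]
      rw [list_sum_map_finset_sum]
      refine Finset.sum_congr rfl fun k _ => ?_
      rw [← Finset.mul_sum, ← ih' l hl k, ← List.sum_map_mul_left]
      congr 2
      ext p; ring
    have h2 : ((contractionsFrom (signedAdd s l) w).map
          fun p => r ^ (p.1 + 1) * altTTrunc n p.2).sum
        = ∑ k ∈ Finset.range n, r * (indexFactor s k * interpTerm r (l :: w) k) := by
      rw [← Finset.mul_sum]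
      simp_rw [← interpTerm_signedAdd r hs hl w]
      rw [← ih' _ (signedAdd_ne_zero l hs) n, ← List.sum_map_mul_left]
      congr 2
      ext p; ring
    rw [contractionsFrom, List.map_append, List.sum_append, List.map_map, List.map_map]
    simp only [Function.comp_def]
    rw [h1, h2, ← Finset.sum_add_distrib]
    refine Finset.sum_congr rfl fun k _ => ?_
    rw [interpTerm]; ring

/-! ### Convergence -/

/-- Sums of reciprocals of odd numbers, whose powers bound all nested sums. -/
noncomputable def oddHarmonic (n : ℕ) : ℝ := ∑ j ∈ Finset.range n, 1 / (2 * (j : ℝ) + 1)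

theorem oddHarmonic_nonneg (n : ℕ) : 0 ≤ oddHarmonic n :=
  Finset.sum_nonneg fun j _ => by positivity

theorem oddHarmonic_mono : Monotone oddHarmonic := fun _ _ h =>
  Finset.sum_le_sum_of_subset_of_nonneg (Finset.range_mono h) fun j _ _ => by positivity

theorem oddHarmonic_le (n : ℕ) : oddHarmonic n ≤ 1 + Real.log n := by
  refine le_trans ?_ (harmonic_le_one_add_log n)
  rw [harmonic, oddHarmonic]
  push_cast
  refine Finset.sum_le_sum fun j _ => ?_
  rw [one_div]
  gcongr
  linarith [(Nat.cast_nonneg j : (0 : ℝ) ≤ j)]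

theorem summable_oddHarmonic_pow (m : ℕ) :
    Summable fun k : ℕ => 1 / (2 * (k : ℝ) + 1) ^ 2 * oddHarmonic (k + 1) ^ m := by
  have hsum : Summable fun k : ℕ => (2 * m + 3 : ℝ) ^ m * (((k + 1 : ℕ) : ℝ) ^ (3 / 2 : ℝ))⁻¹ :=
    ((summable_nat_add_iff 1).2 (Real.summable_nat_rpow_inv.2 (by norm_num))).mul_left _
  refine hsum.of_nonneg_of_le
    (fun k => mul_nonneg (by positivity) (pow_nonneg (oddHarmonic_nonneg _) _)) fun k => ?_
  set x : ℝ := ((k + 1 : ℕ) : ℝ) with hx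
  have hx1 : 1 ≤ x := by rw [hx]; push_cast; linarith [(Nat.cast_nonneg k : (0 : ℝ) ≤ k)]
  have hx0 : 0 < x := by linarith
  -- an exponent whose `m`-th multiple stays below `1/2`
  set e : ℝ := 1 / (2 * m + 2) with he
  have he0 : 0 < e := by positivity
  have hL : oddHarmonic (k + 1) ≤ (2 * m + 3) * x ^ e := by
    have h1 := oddHarmonic_le (k + 1)
    have h2 := Real.log_le_rpow_div hx0.le he0
    have h3 : x ^ e / e = (2 * m + 2) * x ^ e := by rw [he]; field_simp
    have h4 : 1 ≤ x ^ e := Real.one_le_rpow hx1 he0.le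
    rw [← hx] at h1
    nlinarith
  have hp : oddHarmonic (k + 1) ^ m ≤ (2 * m + 3) ^ m * x ^ (1 / 2 : ℝ) := by
    refine (pow_le_pow_left₀ (oddHarmonic_nonneg _) hL m).trans ?_
    rw [mul_pow, ← Real.rpow_mul_natCast hx0.le]
    gcongr
    rw [he, div_mul_eq_mul_div, div_le_div_iff₀ (by positivity) (by norm_num)]
    linarith
  have hq : 1 / (2 * (k : ℝ) + 1) ^ 2 ≤ 1 / x ^ 2 := by
    rw [hx]; push_cast; gcongr; linarith [(Nat.cast_nonneg k : (0 : ℝ) ≤ k)]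
  calc 1 / (2 * (k : ℝ) + 1) ^ 2 * oddHarmonic (k + 1) ^ m
      ≤ 1 / x ^ 2 * ((2 * m + 3) ^ m * x ^ (1 / 2 : ℝ)) :=
        mul_le_mul hq hp (pow_nonneg (oddHarmonic_nonneg _) _) (by positivity)
    _ = (2 * m + 3) ^ m * (x ^ (3 / 2 : ℝ))⁻¹ := by
        have : x ^ (1 / 2 : ℝ) * x ^ (3 / 2 : ℝ) = x ^ 2 := by
          rw [← Real.rpow_add hx0]; norm_num
        field_simp
        rw [this]

theorem abs_indexFactor_le (s : ℤ) {j : ℕ} (h : j ≤ s.natAbs) (k : ℕ) :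
    |indexFactor s k| ≤ 1 / (2 * (k : ℝ) + 1) ^ j := by
  have hk : (0 : ℝ) ≤ k := Nat.cast_nonneg k
  have hs : |(s.sign : ℝ)| ≤ 1 := by
    rcases Int.sign_trichotomy s with h | h | h <;> simp [h]
  rw [indexFactor, abs_div, abs_pow, abs_of_pos (show (0 : ℝ) < (2 * k + 1) ^ s.natAbs by positivity)]
  gcongr
  · exact pow_le_one₀ (abs_nonneg _) hs
  · linarith

theorem sum_indexFactor_mul_le {s : ℤ} (hs : s ≠ 0) {f : ℕ → ℝ} {m : ℕ}
    (hf : ∀ k, |f k| ≤ oddHarmonic (k + 1) ^ m) (n : ℕ) :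
    ∑ k ∈ Finset.range n, |indexFactor s k * f k| ≤ oddHarmonic n ^ (m + 1) := by
  calc ∑ k ∈ Finset.range n, |indexFactor s k * f k|
      ≤ ∑ k ∈ Finset.range n, 1 / (2 * (k : ℝ) + 1) * oddHarmonic n ^ m := by
        refine Finset.sum_le_sum fun k hk => ?_
        rw [abs_mul]
        have h1 := abs_indexFactor_le s (show 1 ≤ s.natAbs by omega) k
        rw [pow_one] at h1
        refine mul_le_mul h1 ((hf k).trans ?_) (abs_nonneg _) (by positivity)
        exact pow_le_pow_left₀ (oddHarmonic_nonneg _)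
          (oddHarmonic_mono (Finset.mem_range.1 hk)) m
    _ = oddHarmonic n ^ (m + 1) := by rw [← Finset.sum_mul, pow_succ', oddHarmonic]

theorem abs_altTTrunc_le (w : List ℤ) (hw : ∀ x ∈ w, x ≠ 0) (n : ℕ) :
    |altTTrunc n w| ≤ oddHarmonic n ^ w.length := by
  induction w generalizing n with
  | nil => simp [altTTrunc]
  | cons s w ih =>
    rw [altTTrunc_cons, List.length_cons]
    refine (Finset.abs_sum_le_sum_abs _ _).trans (sum_indexFactor_mul_le (hw s (by simp)) ?_ n)
    intro k
    exact (ih (fun x hx => hw x (by simp [hx])) k).trans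
      (pow_le_pow_left₀ (oddHarmonic_nonneg _) (oddHarmonic_mono (Nat.le_succ k)) _)

theorem abs_mul_add_sum_le {r : ℝ} (h0 : 0 ≤ r) (h1 : r ≤ 1) (f : ℕ → ℝ) (k : ℕ) :
    |r * f k + ∑ j ∈ Finset.range k, f j| ≤ ∑ j ∈ Finset.range (k + 1), |f j| := by
  rw [Finset.sum_range_succ, add_comm]
  refine (abs_add_le _ _).trans (add_le_add (Finset.abs_sum_le_sum_abs _ _) ?_)
  rw [abs_mul, abs_of_nonneg h0]
  exact mul_le_of_le_one_left (abs_nonneg _) h1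

theorem sum_abs_interpTerm_le {r : ℝ} (h0 : 0 ≤ r) (h1 : r ≤ 1) (w : List ℤ)
    (hw : ∀ x ∈ w, x ≠ 0) (n : ℕ) :
    ∑ k ∈ Finset.range n, |interpTerm r w k| ≤ oddHarmonic n ^ w.length := by
  induction w generalizing n with
  | nil => simp [interpTerm]
  | cons s w ih =>
    have hs : s ≠ 0 := hw s (by simp)
    cases w with
    | nil => simpa [interpTerm] using sum_indexFactor_mul_le (f := fun _ => 1) (m := 0) hs (by simp) n
    | cons l w =>
      refine sum_indexFactor_mul_le hs (fun k => ?_) n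
      exact (abs_mul_add_sum_le h0 h1 _ k).trans (ih (fun x hx => hw x (by simp [hx])) (k + 1))

theorem summable_indexFactor_mul {s : ℤ} (hs : 2 ≤ s.natAbs) {f : ℕ → ℝ} {m : ℕ}
    (hf : ∀ k, |f k| ≤ oddHarmonic (k + 1) ^ m) : Summable fun k => indexFactor s k * f k := by
  refine (summable_oddHarmonic_pow m).of_norm_bounded fun k => ?_
  rw [Real.norm_eq_abs, abs_mul]
  exact mul_le_mul (abs_indexFactor_le s hs k) (hf k) (abs_nonneg _) (by positivity)

theorem summable_interpTerm {r : ℝ} (h0 : 0 ≤ r) (h1 : r ≤ 1) {s : ℤ} (hs : 2 ≤ s.natAbs)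
    (w : List ℤ) (hw : ∀ x ∈ w, x ≠ 0) : Summable (interpTerm r (s :: w)) := by
  cases w with
  | nil => simpa [interpTerm] using summable_indexFactor_mul (f := fun _ => 1) (m := 0) hs (by simp)
  | cons l w =>
    refine summable_indexFactor_mul hs (m := (l :: w).length) fun k => ?_
    exact (abs_mul_add_sum_le h0 h1 _ k).trans (sum_abs_interpTerm_le h0 h1 _ hw (k + 1))

theorem tendsto_altT {s : ℤ} (hs : 2 ≤ s.natAbs) (w : List ℤ) (hw : ∀ x ∈ w, x ≠ 0) :
    Tendsto (fun n => altTTrunc n (s :: w)) atTop (𝓝 (altT (s :: w))) := by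
  refine tendsto_nhds_limUnder ⟨∑' k, indexFactor s k * altTTrunc k w, ?_⟩
  simp_rw [altTTrunc_cons]
  refine (summable_indexFactor_mul hs (m := w.length) fun k => ?_).hasSum.tendsto_sum_nat
  exact (abs_altTTrunc_le w hw k).trans
    (pow_le_pow_left₀ (oddHarmonic_nonneg _) (oddHarmonic_mono (Nat.le_succ k)) _)

/-- Contracting never decreases the absolute value of the first entry, so convergence is
inherited by all the series of an interpolated value. -/
theorem exists_cons_of_mem_contractionsFrom (w : List ℤ) (hw : ∀ x ∈ w, x ≠ 0) (s : ℤ)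
    {p : ℕ × List ℤ} (hp : p ∈ contractionsFrom s w) :
    ∃ t v, p.2 = t :: v ∧ s.natAbs ≤ t.natAbs ∧ ∀ x ∈ v, x ≠ 0 := by
  induction w generalizing s p with
  | nil =>
    obtain rfl : p = (0, [s]) := by simpa [contractionsFrom] using hp
    exact ⟨s, [], rfl, le_rfl, by simp⟩
  | cons l w ih =>
    have hl : l ≠ 0 := hw l (by simp)
    have hw' : ∀ x ∈ w, x ≠ 0 := fun x hx => hw x (by simp [hx])
    rw [contractionsFrom, List.mem_append, List.mem_map, List.mem_map] at hp
    rcases hp with ⟨q, hq, rfl⟩ | ⟨q, hq, rfl⟩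
    · obtain ⟨t, v, h, ht, hv⟩ := ih hw' l hq
      refine ⟨s, q.2, rfl, le_rfl, ?_⟩
      rw [h]
      simp only [List.mem_cons, forall_eq_or_imp]
      exact ⟨by omega, hv⟩
    · obtain ⟨t, v, h, ht, hv⟩ := ih hw' _ hq
      rw [natAbs_signedAdd] at ht
      exact ⟨t, v, h, by omega, hv⟩

theorem tendsto_altT_of_mem_contractions {s : ℤ} (hs : 2 ≤ s.natAbs) {w : List ℤ}
    (hw : ∀ x ∈ w, x ≠ 0) {p : ℕ × List ℤ} (hp : p ∈ contractions (s :: w)) :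
    Tendsto (fun n => altTTrunc n p.2) atTop (𝓝 (altT p.2)) := by
  obtain ⟨t, v, h, ht, hv⟩ := exists_cons_of_mem_contractionsFrom w hw s hp
  rw [h]
  exact tendsto_altT (hs.trans ht) v hv

theorem interpT_eq_tsum {r : ℝ} (h0 : 0 ≤ r) (h1 : r ≤ 1) {s : ℤ} (hs : 2 ≤ s.natAbs)
    {w : List ℤ} (hw : ∀ x ∈ w, x ≠ 0) : interpT r (s :: w) = ∑' k, interpTerm r (s :: w) k := by
  have ht : Tendsto (fun n => ((contractions (s :: w)).map fun p => r ^ p.1 * altTTrunc n p.2).sum)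
      atTop (𝓝 (interpT r (s :: w))) :=
    tendsto_list_sum _ fun p hp => (tendsto_altT_of_mem_contractions hs hw hp).const_mul _
  refine tendsto_nhds_unique ht ?_
  simp_rw [contractions, sum_contractionsFrom r w hw s (show s ≠ 0 by omega)]
  exact (summable_interpTerm h0 h1 hs w hw).hasSum.tendsto_sum_nat

/-! ### Matching the two indices -/

theorem interpTerm_half_cons (s : ℤ) {w : List ℤ} (hw : w ≠ []) (k : ℕ) :
    interpTerm (1 / 2) (s :: w) k
      = indexFactor s k * (midSum (interpTerm (1 / 2) w) k / 2) := by
  obtain ⟨l, w, rfl⟩ := List.exists_cons_of_ne_nil hw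
  simp only [interpTerm, midSum]
  ring

/-- Divisions by the row become a run of entries `1`. -/
theorem neg_one_pow_mul_divRow_iterate {f : ℕ → ℝ} {C : ℝ} {w : List ℤ} (hw : w ≠ [])
    (hf : ∀ k, (-1) ^ k * (f k / (2 * k + 1)) = C * interpTerm (1 / 2) w k) (j k : ℕ) :
    divRow^[j + 1] f k
      = (-1) ^ k * (2 ^ j * C * midSum (interpTerm (1 / 2) (List.replicate j 1 ++ w)) k) := by
  have hmul : ∀ (a : ℝ) (g : ℕ → ℝ) (k : ℕ), midSum (fun l => a * g l) k = a * midSum g k := by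
    intro a g k
    rw [midSum, midSum, ← Finset.mul_sum]; ring
  induction j generalizing k with
  | zero =>
    simp only [zero_add, Function.iterate_one, divRow, hf]
    rw [hmul]; simp
  | succ j ih =>
    rw [Function.iterate_succ_apply', divRow]
    have : (fun l => (-1 : ℝ) ^ l * (divRow^[j + 1] f l / (2 * l + 1)))
        = fun l => 2 ^ (j + 1) * C *
            interpTerm (1 / 2) (List.replicate (j + 1) 1 ++ w) l := by
      ext l
      have h1 : indexFactor 1 l = 1 / (2 * l + 1) := by
        simpa using indexFactor_natCast (m := 1) one_pos l
      rw [ih, List.replicate_succ, List.cons_append, interpTerm_half_cons 1 (by simp [hw]), h1,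
        mul_div_assoc, neg_one_pow_mul_self_mul]
      ring
    rw [this, hmul]

theorem starTerm_replicate_two_append (b : ℕ) (w : List ℕ) (k : ℕ) :
    starTerm (List.replicate b 2 ++ w) k = starTerm w k / (2 * k + 1) ^ (2 * b) := by
  induction b with
  | zero => simp
  | succ b ih =>
    rw [List.replicate_succ, List.cons_append, starTerm]
    simp only [OfNat.ofNat_ne_one, if_false, Nat.sub_self, Function.iterate_zero, id_eq]
    rw [ih, div_div, ← pow_add, mul_add, mul_one]

/-- The number of summations with halved top term that the entry `c` produces. -/
def stepCount (c : ℕ) : ℕ := if c = 1 then 1 else c - 2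

/-- The total number of these summations. -/
def totalSteps (l : List (ℕ × ℕ)) : ℕ := (l.map fun q => stepCount q.1).sum

/-- The sequence inside the innermost summation of the operator of the entry `c`, applied to `f`. -/
noncomputable def innerTerm (c : ℕ) (f : ℕ → ℝ) (k : ℕ) : ℝ :=
  if c = 1 then f k else (-1) ^ k * (f k / (2 * k + 1))

theorem signedTail_ne_nil (c b : ℕ) (l : List (ℕ × ℕ)) : signedTail c b l ≠ [] := by
  cases l <;> simp [signedTail]

/-- One step of the comparison: the entry `c` of the star index, together with the block `{2}^b`
before it, contributes the powers of `2k+1` and of the sign that this block and the left end of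
`c` leave, followed by a run of `c - 3` entries `1`. -/
theorem starTerm_starIndex_cons {c b b' : ℕ} {l : List (ℕ × ℕ)} (hc1 : 1 ≤ c) (hc2 : c ≠ 2)
    (h : ∀ k, innerTerm c (starTerm (starIndex b' l)) k
      = (-1) ^ delta c * 2 ^ totalSteps l * interpTerm (1 / 2) (signedTail c b' l) k) (k : ℕ) :
    starTerm (starIndex b ((c, b') :: l)) k
      = ((-1) ^ k) ^ (1 - delta c) / (2 * k + 1) ^ (2 * b + 2 - delta c)
        * ((-1) ^ delta c * 2 ^ totalSteps ((c, b') :: l)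
          * (midSum (interpTerm (1 / 2)
              (List.replicate (c - 3) 1 ++ signedTail c b' l)) k / 2)) := by
  have hk : (2 * k + 1 : ℝ) ≠ 0 := by positivity
  have hT : totalSteps ((c, b') :: l) = stepCount c + totalSteps l := by simp [totalSteps]
  rw [starIndex, starTerm_replicate_two_append, hT, pow_add]
  by_cases h1 : c = 1
  · subst h1
    have hF : starTerm (starIndex b' l)
        = fun k => -2 ^ totalSteps l * interpTerm (1 / 2) (signedTail 1 b' l) k := by
      ext k
      simpa [innerTerm, delta] using h k
    simp only [starTerm, if_true, stepCount, delta, hF, midSum]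
    rw [← Finset.mul_sum, show 2 * b + 2 - 1 = 2 * b + 1 by omega, pow_succ]
    simp
    field_simp
    ring
  · obtain ⟨j, rfl⟩ : ∃ j, c = j + 3 := ⟨c - 3, by omega⟩
    have hd : delta (j + 3) = 0 := by simp [delta]
    have hF : ∀ k, (-1) ^ k * (starTerm (starIndex b' l) k / (2 * k + 1))
        = 2 ^ totalSteps l * interpTerm (1 / 2) (signedTail (j + 3) b' l) k := by
      intro k
      simpa [innerTerm, hd] using h k
    have hI := neg_one_pow_mul_divRow_iterate (signedTail_ne_nil (j + 3) b' l) hF j k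
    simp only [starTerm, h1, if_false, stepCount, hd]
    rw [show j + 3 - 2 = j + 1 by omega, hI, show j + 3 - 3 = j by omega, Nat.sub_zero,
      Nat.sub_zero, pow_add _ (2 * b) 2]
    field_simp
    ring

theorem delta_eq_zero_or_one (c : ℕ) : (c = 1 ∧ delta c = 1) ∨ (c ≠ 1 ∧ delta c = 0) := by
  unfold delta; split <;> simp_all

/-- The comparison for a tail: by induction on the tail, the part of the star index after `c`
corresponds to the part of the signed index after the run of `1`s of `c`. -/
theorem innerTerm_starTerm (l : List (ℕ × ℕ)) (hl : ∀ q ∈ l, 1 ≤ q.1 ∧ q.1 ≠ 2) (c b k : ℕ) :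
    innerTerm c (starTerm (starIndex b l)) k
      = (-1) ^ delta c * 2 ^ totalSteps l * interpTerm (1 / 2) (signedTail c b l) k := by
  have hsq : ∀ k : ℕ, ((-1 : ℝ) ^ k) ^ 2 = 1 := fun k => by
    rw [← pow_mul, mul_comm, pow_mul]; simp
  induction l generalizing c b k with
  | nil =>
    have hF : starTerm (starIndex b []) k = (-1) ^ k / (2 * k + 1) ^ (2 * b + 1) := by
      have := starTerm_replicate_two_append b [] k
      rw [List.append_nil] at this
      rw [starIndex, this, starTerm, div_div, pow_succ, mul_comm]
    rw [signedTail, interpTerm, innerTerm, hF]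
    rcases delta_eq_zero_or_one c with ⟨h, hd⟩ | ⟨h, hd⟩ <;> simp only [hd] <;>
      simp only [h, if_true, if_false]
    · have := indexFactor_neg_natCast (m := 2 * b + 1) (by omega) k
      rw [show (-1 : ℤ) ^ 1 * (2 * b + 2 - (1 : ℕ)) = -((2 * b + 1 : ℕ) : ℤ) by push_cast; ring,
        this, pow_succ _ k]
      simp [totalSteps, neg_div]
    · have := indexFactor_natCast (m := 2 * b + 2) (by omega) k
      rw [show (-1 : ℤ) ^ 0 * (2 * b + 2 - (0 : ℕ)) = ((2 * b + 2 : ℕ) : ℤ) by push_cast; ring,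
        this, div_div, ← pow_succ, mul_div_assoc', ← sq, hsq]
      simp [totalSteps]
  | cons q l ih =>
    obtain ⟨c', b'⟩ := q
    have hq := hl (c', b') (by simp)
    have h := starTerm_starIndex_cons (b := b) hq.1 hq.2
      (fun k => ih (fun x hx => hl x (by simp [hx])) c' b' k) k
    have hk : (2 * k + 1 : ℝ) ≠ 0 := by positivity
    rw [signedTail, interpTerm_half_cons _ (by simp [signedTail_ne_nil]), innerTerm, h]
    rcases delta_eq_zero_or_one c with ⟨h, hd⟩ | ⟨h, hd⟩ <;>
    rcases delta_eq_zero_or_one c' with ⟨h', hd'⟩ | ⟨h', hd'⟩ <;>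
    simp only [hd, hd'] <;> simp only [h, if_true, if_false]
    · have := indexFactor_natCast (m := 2 * b + 1) (by omega) k
      rw [show (-1 : ℤ) ^ (1 + 1) * (2 * b + 3 - (1 : ℕ) - (1 : ℕ)) = ((2 * b + 1 : ℕ) : ℤ) by
        push_cast; ring, this, show 2 * b + 2 - 1 = 2 * b + 1 by omega]
      ring
    · have := indexFactor_neg_natCast (m := 2 * b + 2) (by omega) k
      rw [show (-1 : ℤ) ^ (1 + 0) * (2 * b + 3 - (1 : ℕ) - (0 : ℕ)) = -((2 * b + 2 : ℕ) : ℤ) by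
        push_cast; ring, this, Nat.sub_zero, Nat.sub_zero]
      ring
    · have := indexFactor_neg_natCast (m := 2 * b + 2) (by omega) k
      rw [show (-1 : ℤ) ^ (0 + 1) * (2 * b + 3 - (0 : ℕ) - (1 : ℕ)) = -((2 * b + 2 : ℕ) : ℤ) by
        push_cast; ring, this, show 2 * b + 2 - 1 = 2 * b + 1 by omega]
      simp only [Nat.sub_self, pow_zero]
      field_simp
      ring
    · have := indexFactor_natCast (m := 2 * b + 3) (by omega) k
      rw [show (-1 : ℤ) ^ (0 + 0) * (2 * b + 3 - (0 : ℕ) - (0 : ℕ)) = ((2 * b + 3 : ℕ) : ℤ) by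
        push_cast; ring, this, Nat.sub_zero, Nat.sub_zero, pow_one, pow_succ _ (2 * b + 2)]
      field_simp
      rw [hsq]
      ring

/-- The sequence of the star index is, up to a constant, that of the signed index. -/
theorem starTerm_starIndex (b : ℕ) (l : List (ℕ × ℕ)) (hl : ∀ q ∈ l, 1 ≤ q.1 ∧ q.1 ≠ 2) (k : ℕ) :
    starTerm (starIndex b l) k
      = -2 ^ totalSteps l * interpTerm (1 / 2) (signedIndex b l) k := by
  cases l with
  | nil =>
    have h := innerTerm_starTerm [] hl 1 b k
    simp only [innerTerm, if_true] at h
    rw [h]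
    simp [signedTail, signedIndex, delta]
    congr 2; ring
  | cons q l =>
    obtain ⟨c, b'⟩ := q
    have hq := hl (c, b') (by simp)
    rw [starTerm_starIndex_cons (b := b) hq.1 hq.2
      (innerTerm_starTerm l (fun x hx => hl x (by simp [hx])) c b') k, signedIndex,
      interpTerm_half_cons _ (by simp [signedTail_ne_nil])]
    rcases delta_eq_zero_or_one c with ⟨-, hd⟩ | ⟨-, hd⟩ <;> simp only [hd]
    · have := indexFactor_natCast (m := 2 * b + 1) (by omega) k
      rw [show (-1 : ℤ) ^ (1 + 1) * (2 * b + 2 - (1 : ℕ)) = ((2 * b + 1 : ℕ) : ℤ) by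
        push_cast; ring, this, show 2 * b + 2 - 1 = 2 * b + 1 by omega]
      ring
    · have := indexFactor_neg_natCast (m := 2 * b + 2) (by omega) k
      rw [show (-1 : ℤ) ^ (0 + 1) * (2 * b + 2 - (0 : ℕ)) = -((2 * b + 2 : ℕ) : ℤ) by
        push_cast; ring, this, Nat.sub_zero, Nat.sub_zero]
      ring

theorem ne_zero_of_mem_signedTail (l : List (ℕ × ℕ)) (c b : ℕ) :
    ∀ x ∈ signedTail c b l, x ≠ 0 := by
  induction l generalizing c b with
  | nil =>
    have := delta_eq_zero_or_one c
    simp only [signedTail, List.mem_singleton, forall_eq]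
    exact mul_ne_zero (by simp) (by omega)
  | cons q l ih =>
    obtain ⟨c', b'⟩ := q
    have := delta_eq_zero_or_one c
    have := delta_eq_zero_or_one c'
    simp only [signedTail, List.mem_cons, List.mem_append, List.mem_replicate]
    rintro x (rfl | ⟨-, rfl⟩ | hx)
    · exact mul_ne_zero (by simp) (by omega)
    · exact one_ne_zero
    · exact ih c' b' x hx

theorem one_le_of_mem_starIndex (l : List (ℕ × ℕ)) (hl : ∀ q ∈ l, 1 ≤ q.1) (b : ℕ) :
    ∀ x ∈ starIndex b l, 1 ≤ x := by
  induction l generalizing b with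
  | nil => simp only [starIndex, List.mem_replicate]; omega
  | cons q l ih =>
    obtain ⟨c, b'⟩ := q
    simp only [starIndex, List.mem_cons, List.mem_append, List.mem_replicate]
    rintro x (h | rfl | hx)
    · omega
    · exact hl (x, b') (by simp)
    · exact ih (fun q hq => hl q (by simp [hq])) b' x hx

/-- Under the convergence condition the first entry of the signed index has absolute value at
least `2`; the index `(-1)`, where the series is only conditionally convergent, is left out. -/
theorem exists_signedIndex_eq_cons {b : ℕ} {l : List (ℕ × ℕ)} (hnil : l = [] → b ≠ 0)
    (hcons : ∀ q ∈ l.head?, b = 0 → 3 ≤ q.1) :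
    ∃ s w, signedIndex b l = s :: w ∧ 2 ≤ s.natAbs ∧ ∀ x ∈ w, x ≠ 0 := by
  cases l with
  | nil => exact ⟨_, _, rfl, by have := hnil rfl; omega, by simp⟩
  | cons q l =>
    obtain ⟨c, b'⟩ := q
    refine ⟨_, _, rfl, ?_, ?_⟩
    · have h3 : b = 0 → 3 ≤ c := hcons (c, b') (by simp)
      have := delta_eq_zero_or_one c
      rw [Int.natAbs_mul, Int.natAbs_pow]
      simp only [Int.natAbs_neg, Int.natAbs_one, one_pow, one_mul]
      omega
    · simp only [List.mem_append, List.mem_replicate]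
      rintro x (⟨-, rfl⟩ | hx)
      · exact one_ne_zero
      · exact ne_zero_of_mem_signedTail l c b' x hx

/-! ### The limit -/

theorem tendsto_tStarTrunc_starIndex {b : ℕ} {l : List (ℕ × ℕ)}
    (hl : ∀ q ∈ l, 1 ≤ q.1 ∧ q.1 ≠ 2) {s : ℤ} {w : List ℤ} (h : signedIndex b l = s :: w)
    (hs : 2 ≤ s.natAbs) (hw : ∀ x ∈ w, x ≠ 0) :
    Tendsto (fun n => tStarTrunc n (starIndex b l)) atTop
      (𝓝 (-(2 ^ (totalSteps l + 2) / Real.pi) * interpT (1 / 2) (signedIndex b l))) := by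
  have hF : starTerm (starIndex b l)
      = fun k => -2 ^ totalSteps l * interpTerm (1 / 2) (s :: w) k := by
    ext k
    rw [starTerm_starIndex b l hl, h]
  have hsum := summable_interpTerm (r := 1 / 2) (by norm_num) (by norm_num) hs w hw
  have ht := tendsto_weightedSum (hsum.mul_left (-2 ^ totalSteps l))
  rw [← hF] at ht
  simp_rw [← tStarTrunc_eq_weightedSum (starIndex b l)
    (one_le_of_mem_starIndex l (fun q hq => (hl q hq).1) b)] at ht
  rw [hF, tsum_mul_left] at ht
  rw [h, interpT_eq_tsum (by norm_num) (by norm_num) hs hw]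
  convert ht using 2
  ring

/-- The index `(-1)` is the Leibniz series. -/
theorem tendsto_altTTrunc_neg_one :
    Tendsto (fun n => altTTrunc n [-1]) atTop (𝓝 (-(Real.pi / 4))) := by
  refine Real.tendsto_sum_pi_div_four.neg.congr fun n => ?_
  rw [altTTrunc_cons, ← Finset.sum_neg_distrib]
  refine Finset.sum_congr rfl fun k _ => ?_
  simp [indexFactor, altTTrunc, pow_succ, neg_div]

theorem totalSteps_pairs {d : ℕ} (b : Fin (d + 1) → ℕ) (c : Fin d → ℕ)
    (hc_pos : ∀ i, 1 ≤ c i) (hc_two : ∀ i, c i ≠ 2) :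
    ((totalSteps (pairs b c) : ℕ) : ℤ) = (∑ i, (c i : ℤ)) - 2 * d + 2 * ∑ i, (delta (c i) : ℤ) := by
  have h : ∀ i, (stepCount (c i) : ℤ) = c i - 2 + 2 * delta (c i) := by
    intro i
    have h1 := hc_pos i
    have h2 := hc_two i
    unfold stepCount delta
    split <;> push_cast <;> omega
  rw [totalSteps, pairs, List.map_ofFn, List.sum_ofFn]
  simp only [Function.comp_def]
  push_cast
  simp_rw [h, Finset.sum_add_distrib, Finset.sum_sub_distrib, ← Finset.mul_sum]
  simp [mul_comm]

end MultipleT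

/-- The multiple `t`-star value at `({2}^{b₀}, c₁, {2}^{b₁}, …, c_d, {2}^{b_d})` as an interpolated
alternating multiple `t`-value with parameter `1/2`; all the series involved converge. -/
theorem mainTheorem6 (d : ℕ) (b : Fin (d + 1) → ℕ) (c : Fin d → ℕ)
    (hc_pos : ∀ i, 1 ≤ c i) (hc_two : ∀ i, c i ≠ 2)
    (hc_first : ∀ hd : 0 < d, b 0 = 0 → 3 ≤ c ⟨0, hd⟩) :
    Tendsto (fun n => MultipleT.tStarTrunc n (MultipleT.starIndex (b 0) (MultipleT.pairs b c))) atTop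
      (𝓝 (MultipleT.tStar (MultipleT.starIndex (b 0) (MultipleT.pairs b c)))) ∧
    (∀ p ∈ MultipleT.contractions (MultipleT.signedIndex (b 0) (MultipleT.pairs b c)),
      Tendsto (fun n => MultipleT.altTTrunc n p.2) atTop (𝓝 (MultipleT.altT p.2))) ∧
    MultipleT.tStar (MultipleT.starIndex (b 0) (MultipleT.pairs b c)) =
      -((2 : ℝ) ^ ((∑ i, (c i : ℤ)) + 2 - 2 * (d : ℤ) + 2 * ∑ i, (MultipleT.delta (c i) : ℤ))
          / Real.pi) * MultipleT.interpT (1 / 2)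
          (MultipleT.signedIndex (b 0) (MultipleT.pairs b c)) := by
  have hexp : (2 : ℝ) ^ ((∑ i, (c i : ℤ)) + 2 - 2 * (d : ℤ)
        + 2 * ∑ i, (MultipleT.delta (c i) : ℤ))
      = 2 ^ (MultipleT.totalSteps (MultipleT.pairs b c) + 2) := by
    rw [← zpow_natCast]
    congr 1
    push_cast
    rw [MultipleT.totalSteps_pairs b c hc_pos hc_two]; ring
  rw [hexp]
  have hl : ∀ q ∈ MultipleT.pairs b c, 1 ≤ q.1 ∧ q.1 ≠ 2 := by
    intro q hq
    rw [MultipleT.pairs, List.mem_ofFn] at hq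
    obtain ⟨i, rfl⟩ := hq
    exact ⟨hc_pos i, hc_two i⟩
  have hcons : ∀ q ∈ (MultipleT.pairs b c).head?, b 0 = 0 → 3 ≤ q.1 := by
    intro q hq
    cases d with
    | zero => simp [MultipleT.pairs] at hq
    | succ d =>
      simp only [MultipleT.pairs, List.ofFn_succ, List.head?_cons, Option.mem_def,
        Option.some.injEq] at hq
      subst hq
      exact hc_first (Nat.succ_pos d)
  generalize MultipleT.pairs b c = l at hl hcons ⊢
  generalize b 0 = b₀ at hcons ⊢
  -- the empty star index, whose signed index `(-1)` converges only conditionally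
  by_cases hnil : l = [] ∧ b₀ = 0
  · obtain ⟨rfl, rfl⟩ := hnil
    have h1 : Tendsto (fun n => MultipleT.tStarTrunc n (MultipleT.starIndex 0 [])) atTop (𝓝 1) := by
      simp [MultipleT.starIndex, MultipleT.tStarTrunc]
    have h2 := MultipleT.tendsto_altTTrunc_neg_one
    have h3 : MultipleT.altT [-1] = -(Real.pi / 4) := h2.limUnder_eq
    refine ⟨tendsto_nhds_limUnder ⟨_, h1⟩, ?_, ?_⟩
    · intro p hp
      obtain rfl : p = (0, [-1]) := by
        simpa [MultipleT.signedIndex, MultipleT.contractions, MultipleT.contractionsFrom] using hp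
      rw [h3]
      exact h2
    · rw [MultipleT.tStar, h1.limUnder_eq]
      have hpi := Real.pi_pos.ne'
      simp [MultipleT.interpT, MultipleT.signedIndex, MultipleT.contractions,
        MultipleT.contractionsFrom, h3, MultipleT.totalSteps]
      field_simp
      norm_num
  · obtain ⟨s, w, h, hs, hw⟩ := MultipleT.exists_signedIndex_eq_cons
      (fun h hb => hnil ⟨h, hb⟩) hcons
    have ht := MultipleT.tendsto_tStarTrunc_starIndex hl h hs hw
    refine ⟨tendsto_nhds_limUnder ⟨_, ht⟩, ?_, ht.limUnder_eq⟩
    rw [h]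
    exact fun p hp => MultipleT.tendsto_altT_of_mem_contractions hs hw hp
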